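/- Let $\mathbb F$ be a field with $\operatorname{char}\mathbb F\neq 2$ and let $\mathcal A$ be a finite-dimensional Malcev algebra over $\mathbb F$, that is, a (nonassociative) $\mathbb F$-algebra with $xy=-yx$ and $(xy)(xz)=((xy)z)x+((yz)x)x+((zx)x)y$ for all $x,y,z\in\mathcal A$. Let $\mathcal S$ be a finite set that generates $\mathcal A$. A *word* in $\mathcal S$ is a bracketed product of finitely many (at least one) elements of $\mathcal S$, its length $l(w)$ is the number of letters, and its *subwords* are $w$ itself and all factors of the multiplications inside $w$. Let $\mathcal L_i$ be the linear span of (the values of) all words of length at most $i$. A word $w$ is *irreducible* if its value does not lie in $\mathcal L_m$ for any $0\le m<l(w)$. A *sprout sequence* of a word $w$ of length at least $2$ is a sequence $(w_1,\dots,w_r)$ obtained as follows: $w_1,w_1'$ are the two factors of the last multiplication of $w$, named so that $l(w_1)\le l(w_1')$; as long as $l(w_j')\ge 2$, $w_{j+1},w_{j+1}'$ are the two factors of the last multiplication of $w_j'$, named so that $l(w_{j+1})\le l(w_{j+1}')$; the process stops when $l(w_r')=1$. A word is *$3$-bounded* if it has length $1$ or has a sprout sequence all of whose members have length less than $3$.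 For a word $w$ with $l(w)\ge2$ put $$\sigma(w)=\min\{t\ge 0:\ w\text{ has a subword of length } l(w)-2t-1\}.$$ A *$p$-step word* of length $l\geq 2$ is an irreducible $3$-bounded word $w$ of length $l$ with $\sigma(w)=p$ such that $\sigma(v)\ge p$ for every irreducible $3$-bounded word $v$ of length $l$. Suppose that there is a $p$-step word in $\mathcal S$ of length $l$ with $p\ge1$. Then there are two irreducible words in $\mathcal S$ of length $l-2$ that are linearly independent modulo $\mathcal L_{l-3}$. -/

import Mathlib

/-- A (not necessarily associative or unital) ring is a Malcev ring when its product is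
anticommutative and satisfies the Malcev identity. -/
structure IsMalcev (A : Type*) [NonUnitalNonAssocRing A] : Prop where
  anticomm : ∀ x y : A, x * y = -(y * x)
  malcev : ∀ x y z : A,
    (x * y) * (x * z) = ((x * y) * z) * x + ((y * z) * x) * x + ((z * x) * x) * y

namespace Word

section Combinatorics

variable {α : Type*}

/-- `IsSubword u w`: the bracketed word `u` is `w` itself or a factor of one of the
multiplications inside `w`. -/
def IsSubword (u : FreeMagma α) : FreeMagma α → Prop
  | .of a => u = .of a
  | .mul x y => u = .mul x y ∨ IsSubword u x ∨ IsSubword u y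

/-- `IsSprout w s`: the list `s` is a sprout sequence of `w`. At each stage the last
multiplication is split into a factor that is not longer, which is recorded, and a factor that is
not shorter, with which the process continues until it is a single letter. Both choices are
allowed when the factors have equal lengths. A single letter gets the empty sequence. -/
inductive IsSprout : FreeMagma α → List (FreeMagma α) → Prop
  | letter (a : α) : IsSprout (FreeMagma.of a) []
  | left (u v : FreeMagma α) (s : List (FreeMagma α)) :
      u.length ≤ v.length → IsSprout v s → IsSprout (u * v) (u :: s)
  | right (u v : FreeMagma α) (s : List (FreeMagma α)) :
      v.length ≤ u.length → IsSprout u s → IsSprout (u * v) (v :: s)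

/-- `w` is `k`-bounded: some sprout sequence of `w` consists of words of length less than `k`
(for a single letter this holds trivially). -/
def IsBounded (k : ℕ) (w : FreeMagma α) : Prop :=
  ∃ s : List (FreeMagma α), IsSprout w s ∧ ∀ u ∈ s, u.length < k

/-- The step function: the least `t` such that `w` has a subword of length `l(w) - 2t - 1`. Such a
`t` exists for every word of length at least two. -/
noncomputable def step (w : FreeMagma α) : ℕ :=
  sInf {t : ℕ | ∃ u : FreeMagma α, IsSubword u w ∧ u.length + 2 * t + 1 = w.length}

end Combinatorics

section Algebra

variable {A : Type*} [NonUnitalNonAssocRing A]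

/-- The value in `A` of a bracketed word in the elements of `S`. -/
def eval (S : Set A) (w : FreeMagma S) : A :=
  FreeMagma.lift (Subtype.val : S → A) w

variable (F : Type*) [Field F] [Module F A]

/-- The linear span of all words in `S` of length at most `i`. All words have positive length, so
it is the zero subspace for `i = 0`. -/
def L (S : Set A) (i : ℕ) : Submodule F A :=
  Submodule.span F {x : A | ∃ w : FreeMagma S, w.length ≤ i ∧ eval S w = x}

/-- A word is irreducible if it is not in the span of the words of length at most `m`, for any
`m` smaller than its length. -/
def IsIrred (S : Set A) (w : FreeMagma S) : Prop :=
  ∀ m : ℕ, m < w.length → eval S w ∉ L F S m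

/-- `w` is a `p`-step word: an irreducible 3-bounded word (of length at least two, where the step
function is defined) whose step function has the value `p`, minimal among all irreducible
3-bounded words of the same length. -/
structure IsStepWord (S : Set A) (p : ℕ) (w : FreeMagma S) : Prop where
  two_le_length : 2 ≤ w.length
  irred : IsIrred F S w
  bounded : IsBounded 3 w
  step_eq : step w = p
  le_step : ∀ v : FreeMagma S, v.length = w.length → IsIrred F S v → IsBounded 3 v → p ≤ step v

end Algebra

end Word

/-! Work modulo `L F S (l - 1)`. The Sagle identity expresses left multiplication by a long word
through left multiplications by shorter ones, so 3-bounded words span each length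
(`eval_mem_boundedSpan_length`). Since p ≥ 1, minimality of the step then kills every product of a
letter with a word of length l - 1. Hence w is, up to sign, (bb')(dz) with b, b' letters and d of
length 1 or 2.

If d is a letter c, the Malcev identity kills (bb')(bz) and (cb')(cz), and its linearization gives
(cb')(bz) ≡ -(bb')(cz) ≢ 0. If d = cc', then p ≥ 2, so (aa')(ey) vanishes too for letters a, a', e.
Multiplications by bb' and cc' then anticommute on z, and each squares to zero there because 2 is
invertible. In both cases two left multiplications separate two words of length l - 2
(`exists_linearIndependent_of_mul`). -/

namespace IsMalcev

/-! ### Identities in Malcev algebras -/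

variable {A : Type*} [NonUnitalNonAssocRing A]

/-- The Malcev identity linearized in its repeated variable. -/
theorem malcev_linearized (hA : IsMalcev A) (x t y z : A) :
    (x * y) * (t * z) + (t * y) * (x * z) =
      ((x * y) * z) * t + ((t * y) * z) * x + ((y * z) * x) * t + ((y * z) * t) * x
        + ((z * x) * t) * y + ((z * t) * x) * y := by
  have h := hA.malcev (x + t) y z
  have hx := hA.malcev x y z
  have ht := hA.malcev t y z
  simp only [add_mul, mul_add] at h
  linear_combination (norm := abel) h - hx - ht

/-- Twice the Sagle identity. -/
theorem sagle_two (hA : IsMalcev A) (x y z t : A) :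
    (x * z) * (y * t) + (x * z) * (y * t) =
      (((x * y) * z) * t + ((y * z) * t) * x + ((z * t) * x) * y + ((t * x) * y) * z) +
      (((x * y) * z) * t + ((y * z) * t) * x + ((z * t) * x) * y + ((t * x) * y) * z) := by
  -- In `h1 - h2 + h3` the pairings (xy)(zt) and (xt)(yz) cancel, while (xz)(yt) occurs twice.
  have h1 := hA.malcev_linearized t x y z
  have h2 := hA.malcev_linearized t y z x
  have h3 := hA.malcev_linearized t z x y
  simp only [hA.anticomm y x, hA.anticomm z x, hA.anticomm t x, hA.anticomm z y,
    hA.anticomm t y, hA.anticomm t z, neg_mul, mul_neg, neg_neg,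
    hA.anticomm (z * t) (x * y), hA.anticomm (y * t) (x * z),
    hA.anticomm (y * z) (x * t)] at h1 h2 h3 ⊢
  linear_combination (norm := abel) h1 - h2 + h3

variable {F : Type*} [Field F] [Module F A]

/-- The Sagle identity, which holds in Malcev algebras of characteristic other than two. -/
theorem sagle (hA : IsMalcev A) (hF : ringChar F ≠ 2) (x y z t : A) :
    (x * z) * (y * t) =
      ((x * y) * z) * t + ((y * z) * t) * x + ((z * t) * x) * y + ((t * x) * y) * z := by
  have h := hA.sagle_two x y z t
  have h2 : (2 : F) ≠ 0 := Ring.two_ne_zero hF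
  rw [← two_smul F, ← two_smul F] at h
  exact smul_right_injective A h2 h

/-- Left multiplication by a triple product in terms of shorter multiplications. -/
theorem triple_mul (hA : IsMalcev A) (hF : ringChar F ≠ 2) (x y z v : A) :
    ((x * y) * z) * v =
      (x * z) * (y * v) + x * ((y * z) * v) - y * (x * (z * v)) + z * (y * (x * v)) := by
  have h := hA.sagle hF x y z v
  rw [hA.anticomm (y * z * v) x, hA.anticomm (z * v * x) y, hA.anticomm (z * v) x,
    hA.anticomm (v * x * y) z, hA.anticomm (v * x) y, hA.anticomm v x] at h
  simp only [mul_neg, neg_neg] at h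
  linear_combination (norm := abel) -h

end IsMalcev

namespace Word

/-! ### Combinatorics of bracketed words -/

section Combinatorics

variable {α : Type*}

theorem isBounded_of (k : ℕ) (a : α) : IsBounded k (FreeMagma.of a) :=
  ⟨[], .letter a, by simp⟩

theorem length_mul (x y : FreeMagma α) : (x * y).length = x.length + y.length := rfl

theorem isBounded_mul_of_le {k : ℕ} {x y : FreeMagma α} (hy : IsBounded k y)
    (hxy : x.length ≤ y.length) (hx : x.length < k) : IsBounded k (x * y) := by
  obtain ⟨s, hs, h⟩ := hy
  refine ⟨x :: s, .left x y s hxy hs, ?_⟩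
  simpa using ⟨hx, h⟩

theorem isBounded_mul_of_ge {k : ℕ} {x y : FreeMagma α} (hx : IsBounded k x)
    (hxy : y.length ≤ x.length) (hy : y.length < k) : IsBounded k (x * y) := by
  obtain ⟨s, hs, h⟩ := hx
  refine ⟨y :: s, .right x y s hxy hs, ?_⟩
  simpa using ⟨hy, h⟩

theorem eq_of_of_length_eq_one {x : FreeMagma α} (h : x.length = 1) :
    ∃ a, x = FreeMagma.of a := by
  cases x with
  | of a => exact ⟨a, rfl⟩
  | mul x y =>
    have := length_mul x y
    have := x.length_pos
    have := y.length_pos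
    change (x * y).length = 1 at h
    omega

theorem eq_mul_of_two_le_length {x : FreeMagma α} (h : 2 ≤ x.length) :
    ∃ u v, x = u * v := by
  cases x with
  | of a => exact absurd h (by simp [FreeMagma.length])
  | mul x y => exact ⟨x, y, rfl⟩

theorem eq_of_mul_of_of_length_eq_two {x : FreeMagma α} (h : x.length = 2) :
    ∃ a b, x = FreeMagma.of a * FreeMagma.of b := by
  obtain ⟨u, v, rfl⟩ := eq_mul_of_two_le_length h.ge
  have := length_mul u v
  have := u.length_pos
  have := v.length_pos
  obtain ⟨a, rfl⟩ := eq_of_of_length_eq_one (x := u) (by omega)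
  obtain ⟨b, rfl⟩ := eq_of_of_length_eq_one (x := v) (by omega)
  exact ⟨a, b, rfl⟩

/-- Multiplying a 3-bounded word by a word of length at most two gives a 3-bounded word. -/
theorem isBounded_three_mul {x y : FreeMagma α} (hy : IsBounded 3 y) (hx : x.length ≤ 2) :
    IsBounded 3 (x * y) := by
  have hxpos := x.length_pos
  by_cases hxy : x.length ≤ y.length
  · exact isBounded_mul_of_le hy hxy (by omega)
  · have := y.length_pos
    obtain ⟨a, b, rfl⟩ := eq_of_mul_of_of_length_eq_two (x := x) (by omega)
    exact isBounded_mul_of_ge (isBounded_mul_of_le (isBounded_of 3 b) le_rfl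
      (by simp [FreeMagma.length])) (by omega) (by omega)

theorem exists_mul_of_isBounded {k : ℕ} {w : FreeMagma α} (hw : IsBounded k w)
    (h : 2 ≤ w.length) :
    ∃ x y, (w = x * y ∨ w = y * x) ∧ x.length < k ∧ x.length ≤ y.length ∧ IsBounded k y := by
  obtain ⟨s, hs, hk⟩ := hw
  cases hs with
  | letter a => exact absurd h (by simp [FreeMagma.length])
  | left u v s huv hs =>
    exact ⟨u, v, .inl rfl, hk u (by simp), huv, s, hs, fun x hx => hk x (by simp [hx])⟩
  | right u v s huv hs =>
    exact ⟨v, u, .inr rfl, hk v (by simp), huv, s, hs, fun x hx => hk x (by simp [hx])⟩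

theorem isSubword_refl (w : FreeMagma α) : IsSubword w w := by
  cases w with
  | of a => rfl
  | mul x y => exact .inl rfl

theorem isSubword_mul_iff {u x y : FreeMagma α} :
    IsSubword u (x * y) ↔ u = x * y ∨ IsSubword u x ∨ IsSubword u y := Iff.rfl

theorem IsSubword.length_le {u w : FreeMagma α} (h : IsSubword u w) : u.length ≤ w.length := by
  induction w with
  | ih1 a => rw [show u = FreeMagma.of a from h]
  | ih2 x y ihx ihy =>
    rw [length_mul]
    rcases isSubword_mul_iff.1 h with rfl | h | h
    · rfl
    · exact (ihx h).trans (Nat.le_add_right _ _)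
    · exact (ihy h).trans (Nat.le_add_left _ _)

theorem step_le {u w : FreeMagma α} {t : ℕ} (hu : IsSubword u w)
    (h : u.length + 2 * t + 1 = w.length) : step w ≤ t :=
  Nat.sInf_le ⟨u, hu, h⟩

/-- The infimum of the empty set is 0, so a positive step is attained. -/
theorem exists_isSubword_of_step_pos {w : FreeMagma α} (h : 0 < step w) :
    ∃ u, IsSubword u w ∧ u.length + 2 * step w + 1 = w.length :=
  Nat.sInf_mem (Nat.nonempty_of_pos_sInf h)

end Combinatorics

/-! ### The length filtration and 3-bounded spanning words -/

section Algebra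

variable {A : Type*} [NonUnitalNonAssocRing A] (S : Set A)

theorem eval_of (a : S) : eval S (FreeMagma.of a) = a := rfl

theorem eval_mul (x y : FreeMagma S) : eval S (x * y) = eval S x * eval S y := rfl

variable (F : Type*) [Field F] [Module F A]

theorem eval_mem_L {w : FreeMagma S} {i : ℕ} (h : w.length ≤ i) : eval S w ∈ L F S i :=
  Submodule.subset_span ⟨w, h, rfl⟩

theorem L_mono {i j : ℕ} (h : i ≤ j) : L F S i ≤ L F S j :=
  Submodule.span_mono fun _ ⟨w, hw, e⟩ => ⟨w, hw.trans h, e⟩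

theorem isIrred_of_notMem {w : FreeMagma S} {i : ℕ} (hi : w.length ≤ i + 1)
    (h : eval S w ∉ L F S i) : IsIrred F S w :=
  fun _ hm hmem => h (L_mono S F (by omega) hmem)

theorem mem_L_of_not_isIrred {w : FreeMagma S} (h : ¬ IsIrred F S w) :
    eval S w ∈ L F S (w.length - 1) := by
  simp only [IsIrred, not_forall, not_not] at h
  obtain ⟨m, hm, h⟩ := h
  exact L_mono S F (by omega) h

/-- The span of the 3-bounded words of length `n`. -/
def boundedSpan (n : ℕ) : Submodule F A :=
  Submodule.span F {x : A | ∃ w : FreeMagma S, IsBounded 3 w ∧ w.length = n ∧ eval S w = x}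

variable {S F}

theorem eval_mem_boundedSpan {w : FreeMagma S} (h : IsBounded 3 w) :
    eval S w ∈ boundedSpan S F w.length :=
  Submodule.subset_span ⟨w, h, rfl, rfl⟩

theorem eval_mem_iff_of_eq_or (hA : IsMalcev A) {w x y : FreeMagma S} (h : w = x * y ∨ w = y * x)
    (K : Submodule F A) : eval S w ∈ K ↔ eval S x * eval S y ∈ K := by
  rcases h with rfl | rfl
  · rw [eval_mul]
  · rw [eval_mul, hA.anticomm, neg_mem_iff]

variable [SMulCommClass F A A]

theorem mul_mem_of_forall_boundedSpan {n : ℕ} {K : Submodule F A} {b : A}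
    (h : ∀ w : FreeMagma S, IsBounded 3 w → w.length = n → b * eval S w ∈ K) {v : A}
    (hv : v ∈ boundedSpan S F n) : b * v ∈ K := by
  refine (Submodule.span_le (p := K.comap (LinearMap.mulLeft F b))).2 ?_ hv
  rintro _ ⟨w, hw, hn, rfl⟩
  exact h w hw hn

theorem mul_mem_L {q : FreeMagma S} {i : ℕ} {v : A} (hv : v ∈ L F S i) :
    eval S q * v ∈ L F S (q.length + i) := by
  refine (Submodule.span_le (p := (L F S (q.length + i)).comap
    (LinearMap.mulLeft F (eval S q)))).2 ?_ hv
  rintro _ ⟨w, hw, rfl⟩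
  refine eval_mem_L S F (w := q * w) ?_
  rw [length_mul]
  omega

theorem mul_mem_boundedSpan_of_length_le_two {q : FreeMagma S} (hq : q.length ≤ 2) {n : ℕ}
    {v : A} (hv : v ∈ boundedSpan S F n) : eval S q * v ∈ boundedSpan S F (q.length + n) := by
  refine mul_mem_of_forall_boundedSpan (fun w hw hn => ?_) hv
  have h := eval_mem_boundedSpan (F := F) (isBounded_three_mul hw hq)
  rwa [length_mul, hn, eval_mul] at h

/-- Induction on the length of q: `triple_mul` turns a triple product into composites of
multiplications by strictly shorter words, until length at most two is reached. -/
theorem mul_mem_boundedSpan (hA : IsMalcev A) (hF : ringChar F ≠ 2) (q : FreeMagma S) {n : ℕ}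
    {v : A} (hv : v ∈ boundedSpan S F n) : eval S q * v ∈ boundedSpan S F (q.length + n) := by
  induction hk : q.length using Nat.strong_induction_on generalizing q n v with
  | _ k ih =>
  subst hk
  by_cases hq : q.length ≤ 2
  · exact mul_mem_boundedSpan_of_length_le_two hq hv
  have key : ∀ x y z : FreeMagma S, x.length + y.length + z.length = q.length →
      eval S ((x * y) * z) * v ∈ boundedSpan S F (q.length + n) := by
    intro x y z h
    have hx := x.length_pos
    have hy := y.length_pos
    have hz := z.length_pos
    have step' : ∀ (r : FreeMagma S) (m : ℕ) (u : A), r.length < q.length →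
        u ∈ boundedSpan S F m → eval S r * u ∈ boundedSpan S F (r.length + m) :=
      fun r m u hr hu => ih r.length hr r hu rfl
    have e1 := step' (x * z) _ _ (by rw [length_mul]; omega) (step' y _ _ (by omega) hv)
    have e2 := step' x _ _ (by omega) (step' (y * z) _ _ (by rw [length_mul]; omega) hv)
    have e3 := step' y _ _ (by omega) (step' x _ _ (by omega) (step' z _ _ (by omega) hv))
    have e4 := step' z _ _ (by omega) (step' y _ _ (by omega) (step' x _ _ (by omega) hv))
    rw [show (x * z).length + (y.length + n) = q.length + n by rw [length_mul]; omega] at e1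
    rw [show x.length + ((y * z).length + n) = q.length + n by rw [length_mul]; omega] at e2
    rw [show y.length + (x.length + (z.length + n)) = q.length + n by omega] at e3
    rw [show z.length + (y.length + (x.length + n)) = q.length + n by omega] at e4
    rw [eval_mul, eval_mul, hA.triple_mul hF]
    exact add_mem (sub_mem (add_mem e1 e2) e3) e4
  -- Up to sign, any word of length at least three is a triple product.
  obtain ⟨a, b, rfl⟩ := eq_mul_of_two_le_length (x := q) (by omega)
  have hab := length_mul a b
  by_cases ha : 2 ≤ a.length
  · obtain ⟨x, y, rfl⟩ := eq_mul_of_two_le_length ha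
    exact key x y b (by simp only [length_mul])
  · obtain ⟨x, y, rfl⟩ := eq_mul_of_two_le_length (x := b) (by omega)
    have := key x y a (by simp only [length_mul]; omega)
    rw [eval_mul, hA.anticomm (eval S (x * y)), neg_mul, neg_mem_iff] at this
    exact this

/-- In a Malcev algebra of characteristic other than two, every word is a linear combination of
3-bounded words of the same length. -/
theorem eval_mem_boundedSpan_length (hA : IsMalcev A) (hF : ringChar F ≠ 2) (w : FreeMagma S) :
    eval S w ∈ boundedSpan S F w.length := by
  induction w with
  | ih1 a => exact eval_mem_boundedSpan (isBounded_of 3 a)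
  | ih2 x y _ ihy => exact mul_mem_boundedSpan hA hF x ihy

/-! ### Consequences of a minimal step -/

/-- For 3-bounded v, the word av is 3-bounded of step 0 < p, so minimality makes it reducible; such
v span. -/
theorem isStepWord_letter_mul_mem (hA : IsMalcev A) (hF : ringChar F ≠ 2) {p : ℕ}
    {w : FreeMagma S} (hw : IsStepWord F S p w) (hp : 1 ≤ p) (a : S) {y : FreeMagma S}
    (hy : y.length + 1 = w.length) : (a : A) * eval S y ∈ L F S (w.length - 1) := by
  refine mul_mem_of_forall_boundedSpan (fun v hv hvy => ?_) (eval_mem_boundedSpan_length hA hF y)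
  have hlen : (FreeMagma.of a * v).length = w.length := by
    rw [length_mul, FreeMagma.length]; omega
  rw [← hlen]
  refine mem_L_of_not_isIrred S F (w := FreeMagma.of a * v) fun hirr => ?_
  have h := hw.le_step _ hlen hirr (isBounded_three_mul hv (by simp [FreeMagma.length]))
  have h0 : step (FreeMagma.of a * v) ≤ 0 :=
    step_le (u := v) (isSubword_mul_iff.2 (.inr (.inr (isSubword_refl v)))) (by omega)
  omega

/-- The same argument one level deeper: b(av) has step at most 1 < p. -/
theorem isStepWord_two_mul_letter_mul_mem (hA : IsMalcev A) (hF : ringChar F ≠ 2) {p : ℕ}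
    {w : FreeMagma S} (hw : IsStepWord F S p w) (hp : 2 ≤ p) {b : FreeMagma S}
    (hb : b.length = 2) (a : S) {y : FreeMagma S} (hy : y.length + 3 = w.length) :
    eval S b * ((a : A) * eval S y) ∈ L F S (w.length - 1) := by
  suffices (LinearMap.mulLeft F (eval S b)) ((a : A) * eval S y) ∈ L F S (w.length - 1) from this
  rw [← Submodule.mem_comap]
  refine mul_mem_of_forall_boundedSpan (fun v hv hvy => ?_) (eval_mem_boundedSpan_length hA hF y)
  rw [Submodule.mem_comap]
  have hlen : (b * (FreeMagma.of a * v)).length = w.length := by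
    rw [length_mul, length_mul, FreeMagma.length]; omega
  rw [← hlen]
  refine mem_L_of_not_isIrred S F (w := b * (FreeMagma.of a * v)) fun hirr => ?_
  have h := hw.le_step _ hlen hirr (isBounded_three_mul (isBounded_three_mul hv
    (by simp [FreeMagma.length])) hb.le)
  have h1 : step (b * (FreeMagma.of a * v)) ≤ 1 :=
    step_le (u := v) (isSubword_mul_iff.2 (.inr (.inr (isSubword_mul_iff.2
      (.inr (.inr (isSubword_refl v))))))) (by omega)
  omega

/-- Two words are irreducible and independent modulo shorter words if two left multiplications
separate them. -/
theorem exists_linearIndependent_of_mul {l : ℕ} (hl : 3 ≤ l) {b c u v : FreeMagma S}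
    (hb : b.length = 2) (hc : c.length = 2) (hu : u.length = l - 2) (hv : v.length = l - 2)
    (hbu : eval S b * eval S u ∉ L F S (l - 1)) (hbv : eval S b * eval S v ∈ L F S (l - 1))
    (hcv : eval S c * eval S v ∉ L F S (l - 1)) (hcu : eval S c * eval S u ∈ L F S (l - 1)) :
    ∃ u v : FreeMagma S,
      u.length = l - 2 ∧ v.length = l - 2 ∧ IsIrred F S u ∧ IsIrred F S v ∧
      LinearIndependent F
        ![(L F S (l - 3)).mkQ (eval S u), (L F S (l - 3)).mkQ (eval S v)] := by
  have low : ∀ (d : FreeMagma S) (x : A), d.length = 2 → x ∈ L F S (l - 3) →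
      eval S d * x ∈ L F S (l - 1) := by
    intro d x hd hx
    have := mul_mem_L (q := d) hx
    rwa [hd, show 2 + (l - 3) = l - 1 by omega] at this
  refine ⟨u, v, hu, hv, isIrred_of_notMem S F (i := l - 3) (by omega) fun h => hbu (low b _ hb h),
    isIrred_of_notMem S F (i := l - 3) (by omega) fun h => hcv (low c _ hc h), ?_⟩
  rw [LinearIndependent.pair_iff]
  intro s t h
  rw [← map_smul, ← map_smul, ← map_add, Submodule.mkQ_apply, Submodule.Quotient.mk_eq_zero] at h
  have h1 := low b _ hb h
  have h2 := low c _ hc h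
  -- Multiplying the relation by b isolates s; multiplying by c isolates t.
  rw [mul_add, mul_smul_comm, mul_smul_comm] at h1 h2
  rw [Submodule.add_mem_iff_left _ (Submodule.smul_mem _ _ hbv)] at h1
  rw [Submodule.add_mem_iff_right _ (Submodule.smul_mem _ _ hcu)] at h2
  constructor
  · by_contra hs
    exact hbu ((Submodule.smul_mem_iff _ hs).1 h1)
  · by_contra ht
    exact hcv ((Submodule.smul_mem_iff _ ht).1 h2)

end Algebra

end Word

/-! ### Malcev relations modulo shorter words -/

namespace Word

variable {F A : Type*} [Field F] [NonUnitalNonAssocRing A] [Module F A] {S : Set A}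

/-- If products of a letter with a word of length `n + 2` lie in `K`, then products
`(xy)(xz)` with letters `x`, `y` and a word `z` of length `n` lie in `K`. -/
theorem malcev_mem (hA : IsMalcev A) {n : ℕ} {K : Submodule F A}
    (hK : ∀ (a : S) (y : FreeMagma S), y.length = n + 2 → (a : A) * eval S y ∈ K)
    (x y : S) {z : FreeMagma S} (hz : z.length = n) :
    ((x : A) * y) * (x * eval S z) ∈ K := by
  have hR : ∀ (a : S) (y : FreeMagma S), y.length = n + 2 → eval S y * (a : A) ∈ K := by
    intro a y hy
    rw [hA.anticomm, neg_mem_iff]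
    exact hK a y hy
  have e1 := hR x ((.of x * .of y) * z) (by simp only [FreeMagma.length]; omega)
  have e2 := hR x ((.of y * z) * .of x) (by simp only [FreeMagma.length]; omega)
  have e3 := hR y ((z * .of x) * .of x) (by simp only [FreeMagma.length]; omega)
  simp only [eval_mul, eval_of] at e1 e2 e3
  rw [hA.malcev]
  exact add_mem (add_mem e1 e2) e3

theorem malcev_linearized_mem (hA : IsMalcev A) {n : ℕ} {K : Submodule F A}
    (hK : ∀ (a : S) (y : FreeMagma S), y.length = n + 2 → (a : A) * eval S y ∈ K)
    (x t y : S) {z : FreeMagma S} (hz : z.length = n) :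
    ((x : A) * y) * (t * eval S z) + ((t : A) * y) * (x * eval S z) ∈ K := by
  have hR : ∀ (a : S) (y : FreeMagma S), y.length = n + 2 → eval S y * (a : A) ∈ K := by
    intro a y hy
    rw [hA.anticomm, neg_mem_iff]
    exact hK a y hy
  have e1 := hR t ((.of x * .of y) * z) (by simp only [FreeMagma.length]; omega)
  have e2 := hR x ((.of t * .of y) * z) (by simp only [FreeMagma.length]; omega)
  have e3 := hR t ((.of y * z) * .of x) (by simp only [FreeMagma.length]; omega)
  have e4 := hR x ((.of y * z) * .of t) (by simp only [FreeMagma.length]; omega)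
  have e5 := hR y ((z * .of x) * .of t) (by simp only [FreeMagma.length]; omega)
  have e6 := hR y ((z * .of t) * .of x) (by simp only [FreeMagma.length]; omega)
  simp only [eval_mul, eval_of] at e1 e2 e3 e4 e5 e6
  rw [hA.malcev_linearized]
  exact add_mem (add_mem (add_mem (add_mem (add_mem e1 e2) e3) e4) e5) e6

/-- Left multiplications by two words of length two anticommute modulo `K`, if `K` contains the
products of length `n + 4` whose last or last but one factor is a letter. -/
theorem two_mul_two_mul_add_mem (hA : IsMalcev A) (hF : ringChar F ≠ 2) {n : ℕ}
    {K : Submodule F A}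
    (hK : ∀ (a : S) (y : FreeMagma S), y.length = n + 3 → (a : A) * eval S y ∈ K)
    (hK' : ∀ (a b c : S) (y : FreeMagma S), y.length = n + 1 →
      ((b : A) * c) * ((a : A) * eval S y) ∈ K)
    (b b' c c' : S) {z : FreeMagma S} (hz : z.length = n) :
    ((b : A) * b') * ((c * c') * eval S z) + ((c : A) * c') * ((b * b') * eval S z) ∈ K := by
  have hR : ∀ (a : S) (y : FreeMagma S), y.length = n + 3 → eval S y * (a : A) ∈ K := by
    intro a y hy
    rw [hA.anticomm, neg_mem_iff]
    exact hK a y hy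
  have e1 := hR b (((.of c * .of c') * .of b') * z)
    (by simp only [FreeMagma.length]; omega)
  have e2 := hR b ((.of b' * z) * (.of c * .of c'))
    (by simp only [FreeMagma.length]; omega)
  have e3 := hR b' ((z * .of b) * (.of c * .of c'))
    (by simp only [FreeMagma.length]; omega)
  have e4 := hR b' ((z * (.of c * .of c')) * .of b)
    (by simp only [FreeMagma.length]; omega)
  have e5 := hK c ((.of c' * .of b') * (.of b * z))
    (by simp only [FreeMagma.length]; omega)
  have e6 := hK c' (.of c * (.of b' * (.of b * z)))
    (by simp only [FreeMagma.length]; omega)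
  have e7 := hK b' (.of c' * (.of c * (.of b * z)))
    (by simp only [FreeMagma.length]; omega)
  have e8 := hK' b c c' (.of b' * z) (by simp only [FreeMagma.length]; omega)
  have e9 := hK' c' c b' (.of b * z) (by simp only [FreeMagma.length]; omega)
  simp only [eval_mul, eval_of] at e1 e2 e3 e4 e5 e6 e7 e8 e9
  -- Linearizing at b and cc' yields both wanted products, the second from ((bb')z)(cc').
  -- `triple_mul` expands ((cc')b')(bz), and all remaining terms lie in K.
  have h := hA.malcev_linearized (b : A) (c * c') b' (eval S z)
  rw [hA.triple_mul hF (c : A) c' b' (b * eval S z),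
    hA.anticomm ((b : A) * b' * eval S z) (c * c'),
    hA.anticomm ((b' : A) * eval S z * b) (c * c'),
    hA.anticomm ((b' : A) * eval S z) b, mul_neg, neg_neg] at h
  have hsum := sub_mem (add_mem (add_mem (add_mem (add_mem (add_mem e1 e2) e3) e4) e8) e6)
    (add_mem (add_mem e9 e5) e7)
  convert hsum using 1
  linear_combination (norm := abel) h

end Word

/-! ### The two shapes of a step word -/

theorem mainTheorem4 {F A : Type*} [Field F] [NonUnitalNonAssocRing A] [Module F A]
    [IsScalarTower F A A] [SMulCommClass F A A] [FiniteDimensional F A]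
    (hchar : ringChar F ≠ 2) (hA : IsMalcev A)
    (S : Set A) (hfin : S.Finite) (hgen : NonUnitalAlgebra.adjoin F S = ⊤)
    (p l : ℕ) (hp : 1 ≤ p) (w : FreeMagma S) (hl : w.length = l)
    (hw : Word.IsStepWord F S p w) :
    ∃ u v : FreeMagma S,
      u.length = l - 2 ∧ v.length = l - 2 ∧ Word.IsIrred F S u ∧ Word.IsIrred F S v ∧
      LinearIndependent F
        ![(Word.L F S (l - 3)).mkQ (Word.eval S u), (Word.L F S (l - 3)).mkQ (Word.eval S v)] := by
  subst hl
  have h2 := hw.two_le_length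
  have hirr := hw.irred (w.length - 1) (by omega)
  have hletter := fun a y hy => Word.isStepWord_letter_mul_mem hA hchar hw hp a (y := y) hy
  obtain ⟨x, y, hxy, hx3, hle, hy⟩ := Word.exists_mul_of_isBounded hw.bounded h2
  have hlen : w.length = x.length + y.length := by
    rcases hxy with rfl | rfl <;> rw [Word.length_mul]
    omega
  have hxpos := x.length_pos
  rw [Word.eval_mem_iff_of_eq_or hA hxy] at hirr
  have hx : x.length = 2 := by
    by_contra hne
    obtain ⟨a, rfl⟩ := Word.eq_of_of_length_eq_one (x := x) (by omega)
    exact hirr (hletter a y (by omega))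
  obtain ⟨b, b', rfl⟩ := Word.eq_of_mul_of_of_length_eq_two hx
  obtain ⟨d, z, hdz, hd3, hdle, -⟩ := Word.exists_mul_of_isBounded hy (by omega)
  have hylen : y.length = d.length + z.length := by
    rcases hdz with rfl | rfl <;> rw [Word.length_mul]
    omega
  have hdpos := d.length_pos
  have hirr' : Word.eval S (FreeMagma.of b * FreeMagma.of b') * Word.eval S (d * z) ∉ Word.L F S (w.length - 1) := by
    rcases hdz with rfl | rfl
    · exact hirr
    · rwa [Word.eval_mul S d z, hA.anticomm (Word.eval S d), mul_neg, neg_mem_iff]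
  obtain hd | hd : d.length = 1 ∨ d.length = 2 := by omega
  · obtain ⟨c, rfl⟩ := Word.eq_of_of_length_eq_one hd
    have hK : ∀ (a : S) (y : FreeMagma S), y.length = z.length + 2 →
        (a : A) * Word.eval S y ∈ Word.L F S (w.length - 1) := fun a y h => hletter a y (by omega)
    have hlin := Word.malcev_linearized_mem hA hK b c b' (z := z) rfl
    refine Word.exists_linearIndependent_of_mul (b := FreeMagma.of b * FreeMagma.of b') (c := FreeMagma.of c * FreeMagma.of b')
      (u := FreeMagma.of c * z) (v := FreeMagma.of b * z) (by omega) rfl rfl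
      (by rw [Word.length_mul]; omega)
      (by rw [Word.length_mul]; simp only [FreeMagma.length] at *; omega) hirr' ?_ ?_ ?_
    · exact Word.malcev_mem hA hK b b' rfl
    · intro hmem
      exact hirr' ((Submodule.add_mem_iff_left _ hmem).1 hlin)
    · exact Word.malcev_mem hA hK c b' rfl
  -- Step 1 needs a subword of length l - 3 ≥ 3, but proper subwords of y lie in d, of length 2, or
  -- in z, of length l - 4.
  · have hp2 : 2 ≤ p := by
      by_contra hlt
      have hstep := hw.step_eq
      obtain ⟨u, hu, hulen⟩ := Word.exists_isSubword_of_step_pos (w := w) (by omega)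
      have hcases : u = w ∨ Word.IsSubword u (FreeMagma.of b * FreeMagma.of b') ∨ Word.IsSubword u y := by
        rcases hxy with rfl | rfl
        · exact Word.isSubword_mul_iff.1 hu
        · exact (Word.isSubword_mul_iff.1 hu).imp_right Or.symm
      rcases hcases with rfl | hu | hu
      · omega
      · have := hu.length_le
        omega
      · have hcases : u = y ∨ Word.IsSubword u d ∨ Word.IsSubword u z := by
          rcases hdz with rfl | rfl
          · exact Word.isSubword_mul_iff.1 hu
          · exact (Word.isSubword_mul_iff.1 hu).imp_right Or.symm
        rcases hcases with rfl | hu | hu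
        · omega
        all_goals
          have := hu.length_le
          omega
    obtain ⟨c, c', rfl⟩ := Word.eq_of_mul_of_of_length_eq_two hd
    have hadd := fun e e' f f' => Word.two_mul_two_mul_add_mem hA hchar (n := z.length)
      (K := Word.L F S (w.length - 1)) (fun a y h => hletter a y (by omega))
      (fun a b c y h => Word.isStepWord_two_mul_letter_mul_mem hA hchar hw hp2
        (b := FreeMagma.of b * FreeMagma.of c) rfl a (y := y) (by omega)) e e' f f' (z := z) rfl
    have hself : ∀ e e' : S, ((e : A) * e') * ((e * e') * Word.eval S z) ∈
        Word.L F S (w.length - 1) := by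
      intro e e'
      have h := hadd e e' e e'
      rw [← two_smul F] at h
      exact (Submodule.smul_mem_iff _ (Ring.two_ne_zero hchar)).1 h
    refine Word.exists_linearIndependent_of_mul (b := FreeMagma.of b * FreeMagma.of b') (c := FreeMagma.of c * FreeMagma.of c')
      (u := (FreeMagma.of c * FreeMagma.of c') * z) (v := (FreeMagma.of b * FreeMagma.of b') * z) (by omega) rfl rfl
      (by rw [Word.length_mul]; omega) (by rw [Word.length_mul]; omega) hirr' (hself b b') ?_
      (hself c c')
    intro hmem
    exact hirr' ((Submodule.add_mem_iff_left _ hmem).1 (hadd b b' c c'))
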